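/- All graphs are finite and simple. For a graph $G$ with vertex set $V$, an edge $e\in E(G)$ and $e'\in E(\overline G)\cup\{e\}$, the edge-replacement $e\to e'$ is feasible if $G-e+e'\cong G$. For a permutation $\sigma$ of $V$ let $G_\sigma$ be the graph on $V$ with edge set $\{\sigma^{-1}(x)\sigma^{-1}(y) : xy\in E(G)\}$, and let $S_G$ be the subgroup of the symmetric group $\mathrm{Sym}(V)$ generated by all $\sigma$ such that $G_\sigma=G-e+e'$ for some feasible edge-replacement $e\to e'$ of $G$. The graph $G$ is a local amoeba if $S_G=\mathrm{Sym}(V)$, and a global amoeba if there is an integer $T\ge 0$ such that the disjoint union $G\cup tK_1$ is a local amoeba for all $t\ge T$. Define the Fibonacci trees by $T_1=T_2=K_2$ and, for $i\ge 2$, let $T_{i+1}$ consist of a copy of $T_{i-1}$ and a disjoint copy of $T_i$ together with one new edge that joins a vertex of maximum degree of the copy of $T_{i-1}$ to a vertex of maximum degree of the copy of $T_i$. Then for every $i\ge 1$ the graph $T_i$ is well defined up to isomorphism (it does not depend on the choice of the vertices of maximum degree), it is a tree of order $2F_i$, where $F_i$ is the $i$-th Fibonacci number ($F_1=F_2=1$),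 and it is a global amoeba. Moreover $\Delta(T_i)=i-1$ for every $i\ge 2$. In particular, there are trees $T_i$ of arbitrarily large maximum degree, all of them global amoebas. -/

import Mathlib

open scoped SimpleGraph

universe u

namespace SimpleGraph

/-- The graph `G - e + e'`. -/
def edgeReplace {V : Type u} (G : SimpleGraph V) (e e' : Sym2 V) : SimpleGraph V :=
  fromEdgeSet (insert e' (G.edgeSet \ {e}))

/-- `e → e'` is a feasible edge-replacement of `G`: `e` is an edge of `G`, `e'` is a non-edge
of `G` or `e` itself, and `G - e + e'` is isomorphic to `G`. -/
def IsFeasibleReplacement {V : Type u} (G : SimpleGraph V) (e e' : Sym2 V) : Prop :=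
  e ∈ G.edgeSet ∧ (e' ∈ Gᶜ.edgeSet ∨ e' = e) ∧ Nonempty (G.edgeReplace e e' ≃g G)

/-- The copy `G_σ` of `G` in the complete graph on `V`: its edges are the pairs
`σ⁻¹(i) σ⁻¹(j)` with `i j` an edge of `G`, that is, `a b` is an edge of `G_σ` if and only if
`σ(a) σ(b)` is an edge of `G`. -/
def permCopy {V : Type u} (G : SimpleGraph V) (σ : Equiv.Perm V) : SimpleGraph V :=
  G.comap σ

/-- The set of all permutations associated with feasible edge-replacements of `G`. -/
def replacementPerms {V : Type u} (G : SimpleGraph V) : Set (Equiv.Perm V) :=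
  {σ | ∃ e e' : Sym2 V, G.IsFeasibleReplacement e e' ∧ G.permCopy σ = G.edgeReplace e e'}

/-- The group `S_G` generated by the permutations associated with feasible edge-replacements. -/
def replacementGroup {V : Type u} (G : SimpleGraph V) : Subgroup (Equiv.Perm V) :=
  Subgroup.closure G.replacementPerms

/-- `G` is a local amoeba if `S_G` is the full symmetric group on the vertices of `G`. -/
def IsLocalAmoeba {V : Type u} (G : SimpleGraph V) : Prop :=
  G.replacementGroup = ⊤

/-- `G` is a global amoeba if adding `t` isolated vertices gives a local amoeba
for all large `t`. -/
def IsGlobalAmoeba {V : Type u} (G : SimpleGraph V) : Prop :=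
  ∃ T : ℕ, ∀ t : ℕ, T ≤ t → (G ⊕g (⊥ : SimpleGraph (Fin t))).IsLocalAmoeba

/-- `IsFibonacciTree i G`: the graph `G` is (a copy of) the Fibonacci tree `T_i`, `i ≥ 1`. Here
`T_1 = T_2 = K_2`, and `T_{i+3}` consists of a copy `H` of `T_{i+1}`, a copy `H'` of `T_{i+2}` and
one new edge joining a vertex of maximum degree of `H` to a vertex of maximum degree of `H'`. -/
inductive IsFibonacciTree : ℕ → ∀ {V : Type u}, SimpleGraph V → Prop
  | one {V : Type u} {G : SimpleGraph V} (φ : G ≃g completeGraph (Fin 2)) :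
      IsFibonacciTree 1 G
  | two {V : Type u} {G : SimpleGraph V} (φ : G ≃g completeGraph (Fin 2)) :
      IsFibonacciTree 2 G
  | step {i : ℕ} {U W V : Type u} [Fintype U] [Fintype W]
      {H : SimpleGraph U} {H' : SimpleGraph W} {G : SimpleGraph V}
      [DecidableRel H.Adj] [DecidableRel H'.Adj]
      (hH : IsFibonacciTree (i + 1) H) (hH' : IsFibonacciTree (i + 2) H')
      (r : U) (r' : W) (hr : H.degree r = H.maxDegree) (hr' : H'.degree r' = H'.maxDegree)
      (φ : G ≃g (H ⊕g H') ⊔ edge (Sum.inl r) (Sum.inr r')) :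
      IsFibonacciTree (i + 3) G

end SimpleGraph

/-! ### Permutations realising edge-replacements -/

namespace SimpleGraph

open Equiv

/-! Root each Fibonacci tree at a vertex of maximum degree and prove a stronger, rooted statement
(`RootedAmoeba`): permutations from replacements that fix the root can carry any other vertex to an
isolated one. Fixing the root is what makes induction possible. When two rooted graphs are joined at
their roots, only the root of a part has neighbours outside it, so such permutations extend to the
join (`viaEmbedding_mem_replacementPerms`, `CanIsolate.map`). The join keeps the right root, so only
the left root remains to be moved.

Two consecutive trees are `G`–`H` and `H`–`K`, so their join contains two copies of `H`, both
attached to the root of `K`. Exchanging the copies changes a single edge, the one to `G`, and sends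
the left root to a non-root vertex on the right (`swapInner`). The same tree is also `H` joined to
`G`–`H`, where exchanging the copies of `H` moves the overall root (`swapOuter`). Hence every vertex
can be isolated, and with enough isolated vertices this yields all transpositions
(`Perm.eq_top_of_forall_exists_inr`).

Uniqueness holds because the vertices of maximum degree form one orbit under automorphisms. -/

lemma edgeReplace_adj {V : Type*} (G : SimpleGraph V) (e e' : Sym2 V) (x y : V) :
    (G.edgeReplace e e').Adj x y ↔ (s(x, y) = e' ∨ G.Adj x y ∧ s(x, y) ≠ e) ∧ x ≠ y := by
  simp [edgeReplace]

/-- A permutation realising an edge-replacement as a copy of `G` makes it feasible. -/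
lemma mem_replacementPerms {V : Type*} {G : SimpleGraph V} {σ : Perm V} {e e' : Sym2 V}
    (he : e ∈ G.edgeSet) (he' : e' ∈ Gᶜ.edgeSet ∨ e' = e)
    (h : G.comap σ = G.edgeReplace e e') : σ ∈ G.replacementPerms :=
  ⟨e, e', ⟨he, he', ⟨by rw [← h]; exact ⟨σ, by simp⟩⟩⟩, h⟩

/-- Automorphisms of a graph with an edge come from a trivial edge-replacement. -/
lemma mem_replacementPerms_of_adj_iff {V : Type*} {G : SimpleGraph V} {σ : Perm V} {a b : V}
    (hab : G.Adj a b) (h : ∀ x y, G.Adj (σ x) (σ y) ↔ G.Adj x y) : σ ∈ G.replacementPerms := by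
  refine mem_replacementPerms (e := s(a, b)) (e' := s(a, b)) hab (.inr rfl) ?_
  ext x y
  rw [edgeReplace_adj, comap_adj, h]
  refine ⟨fun hxy ↦ ⟨?_, hxy.ne⟩, ?_⟩
  · tauto
  · rintro ⟨hxy | hxy, -⟩
    · exact (G.adj_congr_of_sym2 hxy).2 hab
    · exact hxy.1

/-- An involution fixing `c` that preserves adjacency except for the pairs `p c` and `(σ p) c`
realises the replacement of `p c` by `(σ p) c`. -/
lemma mem_replacementPerms_of_involutive {V : Type*} {G : SimpleGraph V} {σ : Perm V} {p c : V}
    (hσ : Function.Involutive σ) (hc : σ c = c) (hpc : G.Adj p c) (hqc : ¬ G.Adj (σ p) c)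
    (h : ∀ x y, s(x, y) ≠ s(p, c) → s(x, y) ≠ s(σ p, c) → G.Adj x y → G.Adj (σ x) (σ y)) :
    σ ∈ G.replacementPerms := by
  have hne : σ p ≠ c := fun h' ↦ hpc.ne (σ.injective (h'.trans hc.symm))
  refine mem_replacementPerms (e := s(p, c)) (e' := s(σ p, c)) hpc (.inl ?_) ?_
  · simpa [hne] using hqc
  · ext x y
    rw [edgeReplace_adj, comap_adj]
    by_cases h1 : s(x, y) = s(p, c)
    · have : s(σ x, σ y) = s(σ p, c) := by
        simpa [hc] using congrArg (Sym2.map σ) h1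
      rw [G.adj_congr_of_sym2 this, h1]
      have : s(p, c) ≠ s(σ p, c) := fun h' ↦ by
        rw [Sym2.congr_left] at h'
        exact hqc (h' ▸ hpc)
      tauto
    · by_cases h2 : s(x, y) = s(σ p, c)
      · have h3 : s(σ x, σ y) = s(p, c) := by
          simpa [hc, hσ p] using congrArg (Sym2.map σ) h2
        rw [G.adj_congr_of_sym2 h3]
        have : x ≠ y := fun h' ↦ by
          subst h'
          exact hne (by have := Sym2.diag_isDiag x; rw [Sym2.diag, h2] at this; simpa using this)
        tauto
      · refine ⟨fun hxy ↦ ?_, fun hxy ↦ ?_⟩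
        -- Only one implication is assumed; its converse is the same implication at `σ x`, `σ y`.
        · have h3 : G.Adj (σ (σ x)) (σ (σ y)) := by
            refine h _ _ (fun h' ↦ h2 ?_) (fun h' ↦ h1 ?_) hxy
            · simpa [hc, hσ x, hσ y] using congrArg (Sym2.map σ) h'
            · simpa [hc, hσ x, hσ y, hσ p] using congrArg (Sym2.map σ) h'
          rw [hσ, hσ] at h3
          exact ⟨.inr ⟨h3, h1⟩, h3.ne⟩
        · exact h _ _ h1 h2 (by tauto)

/-- Two vertices with the same further neighbours, except for one, can be exchanged. -/
lemma swap_mem_replacementPerms {V : Type*} [DecidableEq V] {G : SimpleGraph V} {p q c : V}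
    (hcq : c ≠ q) (hpc : G.Adj p c) (hqc : ¬ G.Adj q c)
    (h : ∀ x, x ≠ p → x ≠ q → x ≠ c → (G.Adj p x ↔ G.Adj q x)) :
    swap p q ∈ G.replacementPerms := by
  refine mem_replacementPerms_of_involutive (p := p) (c := c) (swap_apply_self p q)
    (swap_apply_of_ne_of_ne hpc.ne' hcq) hpc (by simpa) fun x y h1 h2 hxy ↦ ?_
  rw [swap_apply_left] at h2
  have hs := G.adj_comm
  have hne := hxy.ne
  simp only [ne_eq, Sym2.eq_iff, not_or, not_and] at h1 h2
  rw [swap_apply_def, swap_apply_def]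
  split_ifs <;> grind

/-- Permutations attached to edge-replacements extend along an embedding, provided that they fix
all vertices that have neighbours outside of the image. -/
lemma viaEmbedding_mem_replacementPerms {V W : Type*} {G : SimpleGraph V} {H : SimpleGraph W}
    (f : G ↪g H) {σ : Perm V} (hσ : σ ∈ G.replacementPerms)
    (hf : ∀ x y, y ∉ Set.range f → H.Adj (f x) y → σ x = x) :
    σ.viaEmbedding f.toEmbedding ∈ H.replacementPerms := by
  obtain ⟨e, e', ⟨he, he', -⟩, h⟩ := hσ
  have hinj : Function.Injective (Sym2.map f) := Sym2.map.injective f.injective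
  have hin (x) : σ.viaEmbedding f.toEmbedding (f x) = f (σ x) :=
    σ.viaEmbedding_apply f.toEmbedding x
  have hout (y) (hy : y ∉ Set.range f) : σ.viaEmbedding f.toEmbedding y = y :=
    σ.viaEmbedding_apply_of_notMem f.toEmbedding y hy
  have hnm (e : Sym2 V) (x y) (hy : y ∉ Set.range f) : s(x, y) ≠ e.map f := by
    intro h'
    have : y ∈ e.map f := h' ▸ Sym2.mem_mk_right x y
    obtain ⟨z, -, rfl⟩ := Sym2.mem_map.1 this
    exact hy ⟨z, rfl⟩
  refine mem_replacementPerms (e := e.map f) (e' := e'.map f) ?_ ?_ ?_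
  · induction e with | _ a b => simpa using he
  · refine he'.imp (fun he' ↦ ?_) (fun he' ↦ by rw [he'])
    induction e' with | _ a b => simpa using he'
  · have key (x y) (hy : y ∉ Set.range f) :
        H.Adj (σ.viaEmbedding f.toEmbedding x) (σ.viaEmbedding f.toEmbedding y) ↔ H.Adj x y := by
      rw [hout y hy]
      by_cases hx : x ∈ Set.range f
      · obtain ⟨x, rfl⟩ := hx
        rw [hin]
        -- If `f (σ x)` has an outside neighbour, then `σ` fixes `σ x`, and so also `x`.
        refine ⟨fun h' ↦ ?_, fun h' ↦ by rwa [hf x y hy h']⟩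
        rwa [σ.injective (hf _ y hy h')] at h'
      · rw [hout x hx]
    ext x y
    rw [edgeReplace_adj, comap_adj]
    by_cases hy : y ∈ Set.range f
    · by_cases hx : x ∈ Set.range f
      · obtain ⟨x, rfl⟩ := hx
        obtain ⟨y, rfl⟩ := hy
        have := congrArg (fun K : SimpleGraph V ↦ K.Adj x y) h
        simp only [permCopy, comap_adj, edgeReplace_adj, eq_iff_iff] at this
        rw [hin, hin, f.map_adj_iff, this, f.map_adj_iff, f.injective.ne_iff,
          ← Sym2.map_mk, hinj.eq_iff, hinj.ne_iff]
      · rw [H.adj_comm, key y x hx, Sym2.eq_swap, H.adj_comm]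
        have h1 := hnm e y x hx
        have h2 := hnm e' y x hx
        have h3 : H.Adj x y → x ≠ y := fun h ↦ h.ne
        tauto
    · rw [key x y hy]
      have h1 := hnm e x y hy
      have h2 := hnm e' x y hy
      have h3 : H.Adj x y → x ≠ y := fun h ↦ h.ne
      tauto

/-- Being a local amoeba is invariant under isomorphism. -/
lemma IsLocalAmoeba.of_iso {V W : Type*} {G : SimpleGraph V} {H : SimpleGraph W}
    (f : G ≃g H) (hG : G.IsLocalAmoeba) : H.IsLocalAmoeba := by
  have hle : G.replacementGroup ≤ H.replacementGroup.comap
      (Perm.viaEmbeddingHom f.toEmbedding.toEmbedding) := by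
    refine (Subgroup.closure_le _).2 fun σ hσ ↦ Subgroup.subset_closure ?_
    exact viaEmbedding_mem_replacementPerms f.toEmbedding hσ
      fun x y hy ↦ absurd (f.surjective y) hy
  refine eq_top_iff.2 fun τ _ ↦ ?_
  rw [IsLocalAmoeba] at hG
  rw [hG] at hle
  have := hle (Subgroup.mem_top ((f.toEquiv.trans τ).trans f.toEquiv.symm))
  rw [Subgroup.mem_comap] at this
  convert this
  ext y
  obtain ⟨x, rfl⟩ := f.surjective y
  exact ((Perm.viaEmbedding_apply _ f.toEmbedding.toEmbedding x).trans (by simp)).symm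

lemma IsGlobalAmoeba.of_iso {V W : Type*} {G : SimpleGraph V} {H : SimpleGraph W}
    (f : G ≃g H) (hG : G.IsGlobalAmoeba) : H.IsGlobalAmoeba := by
  obtain ⟨T, hT⟩ := hG
  exact ⟨T, fun t ht ↦ (hT t ht).of_iso (f.sumCongr .refl)⟩

/-! ### Generating the full symmetric group -/

/-- A group of permutations of a sum that contains all transpositions of the right summand, which
is larger than the left one, and that moves every point into the right summand, is everything. -/
lemma _root_.Equiv.Perm.eq_top_of_forall_exists_inr {V Z : Type*} [Finite V] [Finite Z]
    [DecidableEq (V ⊕ Z)]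
    (S : Subgroup (Perm (V ⊕ Z))) (hVZ : Nat.card V < Nat.card Z)
    (hZ : ∀ z z' : Z, swap (Sum.inr z) (Sum.inr z') ∈ S)
    (hV : ∀ v : V, ∃ σ ∈ S, ∃ z, σ (Sum.inl v) = Sum.inr z) : S = ⊤ := by
  obtain ⟨z₀⟩ : Nonempty Z := (Nat.card_pos_iff.1 (by omega)).1
  have h0 : ∀ x : V ⊕ Z, swap x (Sum.inr z₀) ∈ S := by
    rintro (v | z)
    · obtain ⟨σ, hσ, z, hz⟩ := hV v
      -- Pigeonhole: the larger summand cannot be mapped entirely into the smaller one.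
      obtain ⟨w, z', hw⟩ : ∃ w z', σ (Sum.inr w) = Sum.inr z' := by
        by_contra! hcon
        have hl : ∀ w, ∃ v, σ (Sum.inr w) = Sum.inl v := fun w ↦ by
          rcases hs : σ (Sum.inr w) with v | z'
          · exact ⟨v, rfl⟩
          · exact absurd hs (hcon w z')
        choose g hg using hl
        have hginj : Function.Injective g := fun a b hab ↦
          Sum.inr_injective (σ.injective (by rw [hg, hg, hab]))
        exact absurd (Nat.card_le_card_of_injective g hginj) (by omega)
      refine SubmonoidClass.swap_mem_trans S ?_ (hZ w z₀)
      -- Conjugating the transposition of `z` and `z'` by `σ` gives that of `v` and `w`.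
      have := S.mul_mem (S.mul_mem (S.inv_mem hσ) (hZ z z')) hσ
      rw [← hz, ← hw, swap_apply_apply] at this
      simpa [mul_assoc] using this
    · exact hZ z z₀
  rw [eq_top_iff, ← Perm.closure_isSwap, Subgroup.closure_le]
  rintro _ ⟨x, y, -, rfl⟩
  exact SubmonoidClass.swap_mem_trans S (h0 x) (swap_comm y _ ▸ h0 y)

/-! ### Joins at roots and rooted amoebas -/

section Join

variable {U V W Z : Type*} {G : SimpleGraph U} {H : SimpleGraph V} {K : SimpleGraph W}

/-- The disjoint union of `G` and `H` with an additional edge from `r` to `s`. -/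
def join (G : SimpleGraph U) (r : U) (H : SimpleGraph V) (s : V) : SimpleGraph (U ⊕ V) :=
  (G ⊕g H) ⊔ edge (Sum.inl r) (Sum.inr s)

variable {r : U} {s : V} {q : W} {t : ℕ}

@[simp] lemma join_adj_inl_inl (x y : U) :
    (G.join r H s).Adj (Sum.inl x) (Sum.inl y) ↔ G.Adj x y := by
  simp [join, edge_adj]

@[simp] lemma join_adj_inr_inr (x y : V) :
    (G.join r H s).Adj (Sum.inr x) (Sum.inr y) ↔ H.Adj x y := by
  simp [join, edge_adj]

@[simp] lemma join_adj_inl_inr (x : U) (y : V) :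
    (G.join r H s).Adj (Sum.inl x) (Sum.inr y) ↔ x = r ∧ y = s := by
  simp [join, edge_adj]

@[simp] lemma join_adj_inr_inl (y : V) (x : U) :
    (G.join r H s).Adj (Sum.inr y) (Sum.inl x) ↔ x = r ∧ y = s := by
  rw [adj_comm, join_adj_inl_inr]

/-- The group generated by those permutations attached to edge-replacements of `G ∪ tK₁` that fix
the vertex `r` of `G`. -/
def rootedGroup (G : SimpleGraph U) (r : U) (t : ℕ) : Subgroup (Perm (U ⊕ Fin t)) :=
  Subgroup.closure {σ | σ ∈ (G ⊕g (⊥ : SimpleGraph (Fin t))).replacementPerms ∧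
    σ (Sum.inl r) = Sum.inl r}

/-- Edge-replacements of `G ∪ tK₁` fixing `r` can make `v` isolated. -/
def CanIsolate (G : SimpleGraph U) (r : U) (t : ℕ) (v : U) : Prop :=
  ∃ σ ∈ G.rootedGroup r t, ∃ z, σ (Sum.inl v) = Sum.inr z

/-- Edge-replacements fixing `r` can make every vertex other than `r` isolated. -/
def RootedAmoeba (G : SimpleGraph U) (r : U) : Prop :=
  ∀ t : ℕ, 1 ≤ t → ∀ v, v ≠ r → G.CanIsolate r t v

lemma CanIsolate.of_perm {σ : Perm (U ⊕ Fin t)} {v w : U}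
    (hσ : σ ∈ (G ⊕g (⊥ : SimpleGraph (Fin t))).replacementPerms)
    (hr : σ (Sum.inl r) = Sum.inl r) (hv : σ (Sum.inl v) = Sum.inl w) (hw : G.CanIsolate r t w) :
    G.CanIsolate r t v := by
  obtain ⟨τ, hτ, z, hz⟩ := hw
  exact ⟨τ * σ, mul_mem hτ (Subgroup.subset_closure ⟨hσ, hr⟩), z, by simp [hv, hz]⟩

/-- Isolation of vertices in a part of a graph that is attached at its root only. -/
lemma CanIsolate.map {v : U} (f : G ↪g H) (hf : ∀ x y, y ∉ Set.range f → H.Adj (f x) y → x = r)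
    (hs : ∀ x, f x = s → x = r) (hv : G.CanIsolate r t v) : H.CanIsolate s t (f v) := by
  obtain ⟨σ, hσ, z, hz⟩ := hv
  let g : (G ⊕g (⊥ : SimpleGraph (Fin t))) ↪g (H ⊕g (⊥ : SimpleGraph (Fin t))) :=
    f.sum (.refl)
  have hle : G.rootedGroup r t ≤ (H.rootedGroup s t).comap
      (Perm.viaEmbeddingHom g.toEmbedding) := by
    refine (Subgroup.closure_le _).2 fun σ ⟨hσ, hr⟩ ↦ Subgroup.subset_closure ⟨?_, ?_⟩
    · refine viaEmbedding_mem_replacementPerms g hσ ?_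
      rintro (x | x) (y | y) hy hxy
      · have : x = r := hf x y (fun ⟨w, hw⟩ ↦ hy ⟨Sum.inl w, by simp [g, hw]⟩)
            (by simpa [g] using hxy)
        rw [this, hr]
      all_goals simp [g] at hxy
    · rw [Perm.viaEmbeddingHom_apply]
      -- The new root `s` is either the image of `r`, which is fixed, or outside the image, where
      -- the extension is the identity.
      by_cases hsr : Sum.inl s ∈ Set.range g
      · obtain ⟨x | x, hx⟩ := hsr
        · have hxr : x = r := hs x (by simpa [g] using hx)
          subst hxr
          rw [← hx]
          exact (σ.viaEmbedding_apply g.toEmbedding _).trans (by rw [hr]; rfl)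
        · simp [g] at hx
      · exact σ.viaEmbedding_apply_of_notMem g.toEmbedding _ hsr
  refine ⟨_, hle hσ, z, ?_⟩
  exact (σ.viaEmbedding_apply g.toEmbedding (Sum.inl v)).trans (by rw [hz]; rfl)

/-- The embedding of the left part into a join. -/
def joinInl (G : SimpleGraph U) (r : U) (H : SimpleGraph V) (s : V) : G ↪g G.join r H s :=
  ⟨.inl, by simp⟩

/-- The embedding of the right part into a join. -/
def joinInr (G : SimpleGraph U) (r : U) (H : SimpleGraph V) (s : V) : H ↪g G.join r H s :=
  ⟨.inr, by simp⟩

lemma CanIsolate.join_inl {v : U} (hv : G.CanIsolate r t v) :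
    (G.join r H s).CanIsolate (Sum.inr s) t (Sum.inl v) := by
  refine hv.map (G.joinInl r H s) ?_ (by simp [joinInl])
  rintro x (y | y) <;> simp +contextual [joinInl]

lemma CanIsolate.join_inr {v : V} (hv : H.CanIsolate s t v) :
    (G.join r H s).CanIsolate (Sum.inr s) t (Sum.inr v) := by
  refine hv.map (G.joinInr r H s) ?_ (by simp [joinInr])
  rintro x (y | y) <;> simp +contextual [joinInr]

/-- For a join it is enough to move the root of the left part. -/
lemma RootedAmoeba.join (hG : G.RootedAmoeba r) (hH : H.RootedAmoeba s)
    (h : ∀ t : ℕ, 1 ≤ t → ∃ σ ∈ ((G.join r H s) ⊕g (⊥ : SimpleGraph (Fin t))).replacementPerms,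
      σ (Sum.inl (Sum.inr s)) = Sum.inl (Sum.inr s) ∧
      ∃ w, w ≠ s ∧ σ (Sum.inl (Sum.inl r)) = Sum.inl (Sum.inr w)) :
    (G.join r H s).RootedAmoeba (Sum.inr s) := by
  rintro t ht (v | v) hv
  · by_cases hvr : v = r
    · obtain ⟨σ, hσ, hs, w, hw, hr⟩ := h t ht
      subst hvr
      exact .of_perm hσ hs hr (hH t ht w hw).join_inr
    · exact (hG t ht v hvr).join_inl
  · exact (hH t ht v (by simpa using hv)).join_inr

/-- A graph with an edge is a global amoeba if all vertices but one can be isolated while that one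
is fixed, and that one can be moved. -/
lemma RootedAmoeba.isGlobalAmoeba [Finite U] (hG : G.RootedAmoeba r) {a b : U} (hab : G.Adj a b)
    (h : ∀ t : ℕ, 1 ≤ t → ∃ σ ∈ (G ⊕g (⊥ : SimpleGraph (Fin t))).replacementPerms,
      σ (Sum.inl r) ≠ Sum.inl r) : G.IsGlobalAmoeba := by
  classical
  -- The isolated vertices must outnumber those of `G` for the pigeonhole step.
  refine ⟨Nat.card U + 1, fun t ht ↦ Perm.eq_top_of_forall_exists_inr _ (by simpa) ?_ ?_⟩
  · refine fun z z' ↦ Subgroup.subset_closure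
      (mem_replacementPerms_of_adj_iff (a := Sum.inl a) (b := Sum.inl b) (by simpa) ?_)
    rintro (x | x) (y | y) <;> simp only [swap_apply_def] <;> split_ifs <;> simp_all
  · have hle : G.rootedGroup r t ≤ (G ⊕g (⊥ : SimpleGraph (Fin t))).replacementGroup :=
      Subgroup.closure_mono fun σ hσ ↦ hσ.1
    intro v
    by_cases hv : v = r
    · obtain ⟨σ, hσ, hσr⟩ := h t (by omega)
      have hσ' : σ ∈ (G ⊕g (⊥ : SimpleGraph (Fin t))).replacementGroup :=
        Subgroup.subset_closure hσ
      subst hv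
      rcases hw : σ (Sum.inl v) with w | z
      · obtain ⟨τ, hτ, z, hz⟩ := hG t (by omega) w (fun h' ↦ hσr (h' ▸ hw))
        exact ⟨τ * σ, mul_mem (hle hτ) hσ', z, by simp [hw, hz]⟩
      · exact ⟨σ, hσ', z, hw⟩
    · obtain ⟨τ, hτ, z, hz⟩ := hG t (by omega) v hv
      exact ⟨τ, hle hτ, z, hz⟩

/-- Exchange of the two inner summands. -/
def swapInner (X Y Z W : Type*) : ((X ⊕ Y) ⊕ (Y ⊕ Z)) ⊕ W → ((X ⊕ Y) ⊕ (Y ⊕ Z)) ⊕ W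
  | .inl (.inl (.inr y)) => .inl (.inr (.inl y))
  | .inl (.inr (.inl y)) => .inl (.inl (.inr y))
  | x => x

lemma swapInner_involutive (X Y Z W : Type*) : Function.Involutive (swapInner X Y Z W) := by
  rintro (((x | x) | (x | x)) | x) <;> rfl

/-- Exchange of the two outer summands. -/
def swapOuter (X Y W : Type*) : (Y ⊕ (X ⊕ Y)) ⊕ W → (Y ⊕ (X ⊕ Y)) ⊕ W
  | .inl (.inl y) => .inl (.inr (.inr y))
  | .inl (.inr (.inr y)) => .inl (.inl y)
  | x => x

lemma swapOuter_involutive (X Y W : Type*) : Function.Involutive (swapOuter X Y W) := by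
  rintro ((x | (x | x)) | x) <;> rfl

/-- Both copies of `H` hang from `q` by their roots; only the edge to `r` tells them apart, so the
exchange just moves that edge. -/
lemma swapInner_mem_replacementPerms :
    (swapInner_involutive U V W Z).toPerm ∈
      (((G.join r H s).join (Sum.inr s) (H.join s K q) (Sum.inr q)) ⊕g
        (⊥ : SimpleGraph Z)).replacementPerms := by
  refine mem_replacementPerms_of_involutive (p := .inl (.inl (.inr s))) (c := .inl (.inl (.inl r)))
    (swapInner_involutive U V W Z) rfl ?_ ?_ ?_
  · simp
  · simp [swapInner]
  · rintro (((x | x) | (x | x)) | x) (((y | y) | (y | y)) | y) <;>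
      simp +contextual [swapInner]
    tauto

/-- The edge between the two copies of `H` is preserved by the exchange, so only the edge to `r`
moves. -/
lemma swapOuter_mem_replacementPerms :
    (swapOuter_involutive U V Z).toPerm ∈
      ((H.join s (G.join r H s) (Sum.inr s)) ⊕g (⊥ : SimpleGraph Z)).replacementPerms := by
  refine mem_replacementPerms_of_involutive (p := .inl (.inr (.inr s))) (c := .inl (.inr (.inl r)))
    (swapOuter_involutive U V Z) rfl ?_ ?_ ?_
  · simp
  · simp [swapOuter]
  · rintro ((x | (x | x)) | x) ((y | (y | y)) | y) <;>
      simp +contextual [swapOuter]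
    tauto

/-- The vertex `r` has a neighbour of degree one. -/
def HasLeafAt (G : SimpleGraph U) (r : U) : Prop :=
  ∃ l, ∀ x, G.Adj l x ↔ x = r

lemma HasLeafAt.join (hH : H.HasLeafAt s) : (G.join r H s).HasLeafAt (Sum.inr s) := by
  obtain ⟨l, hl⟩ := hH
  have hls : l ≠ s := fun h ↦ H.loopless.irrefl l ((hl l).2 h)
  refine ⟨Sum.inr l, ?_⟩
  rintro (x | x) <;> simp [hl, hls]

end Join

/-! ### Base cases and the inductive step -/

/-- A single edge, rooted at the vertex `⟨0⟩`. -/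
abbrev singleEdge : SimpleGraph (ULift.{u} (Fin 2)) := ⊤

lemma ulift_fin_two_eq (x : ULift.{u} (Fin 2)) : x = ⟨0⟩ ∨ x = ⟨1⟩ := by
  obtain ⟨x⟩ := x
  fin_cases x <;> simp

lemma hasLeafAt_singleEdge : singleEdge.{u}.HasLeafAt ⟨0⟩ := by
  refine ⟨⟨1⟩, fun x ↦ ?_⟩
  obtain rfl | rfl := ulift_fin_two_eq x <;> simp

lemma rootedAmoeba_singleEdge : singleEdge.{u}.RootedAmoeba ⟨0⟩ := by
  classical
  intro t ht v hv
  have hv : v = ⟨1⟩ := (ulift_fin_two_eq v).resolve_left hv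
  refine ⟨swap (Sum.inl v) (Sum.inr ⟨0, ht⟩), Subgroup.subset_closure ⟨?_, ?_⟩, ⟨0, ht⟩, by simp⟩
  · refine swap_mem_replacementPerms (c := Sum.inl ⟨0⟩) (by simp) (by simp [hv]) (by simp) ?_
    rintro (x | x)
    · obtain rfl | rfl := ulift_fin_two_eq x <;> simp [hv]
    · simp
  · exact swap_apply_of_ne_of_ne (by simp [hv]) (by simp)

/-- A single edge does not decompose, so `swapInner` is unavailable. Instead its root is exchanged
with a leaf at `s`: both are adjacent to `s`, and they differ only in the pendant vertex `⟨1⟩`. -/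
lemma RootedAmoeba.singleEdge_join {V : Type*} {H : SimpleGraph V} {s : V}
    (hH : H.RootedAmoeba s) (hl : H.HasLeafAt s) :
    (singleEdge.{u}.join ⟨0⟩ H s).RootedAmoeba (Sum.inr s) := by
  classical
  refine rootedAmoeba_singleEdge.join hH fun t ht ↦ ?_
  obtain ⟨l, hl⟩ := hl
  have hls : l ≠ s := fun h ↦ H.loopless.irrefl l ((hl l).2 h)
  refine ⟨swap (Sum.inl (Sum.inl ⟨0⟩)) (Sum.inl (Sum.inr l)), ?_, ?_, l, hls, by simp⟩
  · refine swap_mem_replacementPerms (c := Sum.inl (Sum.inl ⟨1⟩)) (by simp) (by simp) (by simp) ?_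
    rintro ((x | x) | x)
    · obtain rfl | rfl := ulift_fin_two_eq x <;> simp
    · simp [hl]
    · simp
  · exact swap_apply_of_ne_of_ne (by simp) (by simpa using hls.symm)

lemma RootedAmoeba.join_join_join {U V W : Type*} {G : SimpleGraph U} {H : SimpleGraph V}
    {K : SimpleGraph W} {r : U} {s : V} {q : W} (h₁ : (G.join r H s).RootedAmoeba (Sum.inr s))
    (h₂ : (H.join s K q).RootedAmoeba (Sum.inr q)) :
    ((G.join r H s).join (Sum.inr s) (H.join s K q) (Sum.inr q)).RootedAmoeba
      (Sum.inr (Sum.inr q)) :=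
  h₁.join h₂ fun _ _ ↦ ⟨_, swapInner_mem_replacementPerms, rfl, Sum.inl s, by simp, rfl⟩

lemma isGlobalAmoeba_singleEdge : singleEdge.{u}.IsGlobalAmoeba := by
  classical
  refine rootedAmoeba_singleEdge.isGlobalAmoeba (a := ⟨0⟩) (b := ⟨1⟩) (by simp) fun t ht ↦
    ⟨swap (Sum.inl ⟨0⟩) (Sum.inr ⟨0, ht⟩), ?_, by simp⟩
  refine swap_mem_replacementPerms (c := Sum.inl ⟨1⟩) (by simp) (by simp) (by simp) ?_
  rintro (x | x)
  · obtain rfl | rfl := ulift_fin_two_eq x <;> simp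
  · simp

lemma isGlobalAmoeba_singleEdge_join_singleEdge :
    (singleEdge.{u}.join ⟨0⟩ singleEdge.{u} ⟨0⟩).IsGlobalAmoeba := by
  classical
  refine (rootedAmoeba_singleEdge.singleEdge_join hasLeafAt_singleEdge).isGlobalAmoeba
    (a := Sum.inl ⟨0⟩) (b := Sum.inl ⟨1⟩) (by simp) fun t ht ↦
    ⟨swap (Sum.inl (Sum.inr ⟨0⟩)) (Sum.inl (Sum.inr ⟨1⟩)), ?_, by simp⟩
  refine swap_mem_replacementPerms (c := Sum.inl (Sum.inl ⟨0⟩)) (by simp) (by simp) (by simp) ?_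
  rintro ((x | x) | x)
  · obtain rfl | rfl := ulift_fin_two_eq x <;> simp
  · obtain rfl | rfl := ulift_fin_two_eq x <;> simp
  · simp

lemma RootedAmoeba.isGlobalAmoeba_join_join {U V : Type*} [Finite U] [Finite V]
    {G : SimpleGraph U} {H : SimpleGraph V} {r : U} {s : V}
    (h : (H.join s (G.join r H s) (Sum.inr s)).RootedAmoeba (Sum.inr (Sum.inr s))) :
    (H.join s (G.join r H s) (Sum.inr s)).IsGlobalAmoeba :=
  h.isGlobalAmoeba (a := Sum.inl s) (b := Sum.inr (Sum.inr s)) (by simp) fun _ _ ↦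
    ⟨_, swapOuter_mem_replacementPerms, by simp [swapOuter]⟩

/-! ### Rooted Fibonacci trees -/

/-- A finite graph with a distinguished vertex. -/
structure RootedGraph where
  /-- The vertices. -/
  V : Type u
  /-- There are finitely many vertices. -/
  fintype : Fintype V
  /-- The graph. -/
  G : SimpleGraph V
  /-- The distinguished vertex. -/
  root : V

attribute [instance] RootedGraph.fintype

/-- The join of two rooted graphs by an edge between the roots, rooted at the second root. -/
def RootedGraph.join (A B : RootedGraph.{u}) : RootedGraph.{u} :=
  ⟨A.V ⊕ B.V, inferInstance, A.G.join A.root B.G B.root, Sum.inr B.root⟩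

/-- The Fibonacci tree `T_{n+1}`, rooted at a vertex of maximum degree. -/
def fibTree : ℕ → RootedGraph.{u}
  | 0 => ⟨_, inferInstance, singleEdge, ⟨0⟩⟩
  | 1 => ⟨_, inferInstance, singleEdge, ⟨0⟩⟩
  | n + 2 => (fibTree n).join (fibTree (n + 1))

lemma fibTree_zero : fibTree.{u} 0 = ⟨_, inferInstance, singleEdge, ⟨0⟩⟩ := by rw [fibTree]

lemma fibTree_one : fibTree.{u} 1 = ⟨_, inferInstance, singleEdge, ⟨0⟩⟩ := by rw [fibTree]

lemma fibTree_add_two (n : ℕ) :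
    fibTree.{u} (n + 2) = (fibTree n).join (fibTree (n + 1)) := by rw [fibTree]

lemma hasLeafAt_fibTree (n : ℕ) : (fibTree.{u} n).G.HasLeafAt (fibTree.{u} n).root := by
  induction n using Nat.twoStepInduction with
  | zero => rw [fibTree_zero]; exact hasLeafAt_singleEdge
  | one => rw [fibTree_one]; exact hasLeafAt_singleEdge
  | more n _ ih => rw [fibTree_add_two]; exact ih.join

lemma rootedAmoeba_fibTree (n : ℕ) :
    (fibTree.{u} n).G.RootedAmoeba (fibTree.{u} n).root := by
  induction n using Nat.strong_induction_on with
  | _ n ih =>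
    match n, ih with
    | 0, _ => rw [fibTree_zero]; exact rootedAmoeba_singleEdge
    | 1, _ => rw [fibTree_one]; exact rootedAmoeba_singleEdge
    | 2, ih =>
      rw [fibTree_add_two, fibTree_zero]
      exact (ih 1 (by omega)).singleEdge_join (hasLeafAt_fibTree 1)
    | 3, ih =>
      rw [fibTree_add_two, fibTree_one]
      exact (ih 2 (by omega)).singleEdge_join (hasLeafAt_fibTree 2)
    -- From here on both parts are themselves joins, sharing `fibTree (n + 1)`.
    | n + 4, ih =>
      have h₁ := ih (n + 2) (by omega)
      have h₂ := ih (n + 3) (by omega)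
      rw [fibTree_add_two] at h₁ h₂
      rw [fibTree_add_two (n + 2), fibTree_add_two n, fibTree_add_two (n + 1)]
      exact h₁.join_join_join h₂

lemma isGlobalAmoeba_fibTree (n : ℕ) : (fibTree.{u} n).G.IsGlobalAmoeba := by
  match n with
  | 0 => rw [fibTree_zero]; exact isGlobalAmoeba_singleEdge
  | 1 => rw [fibTree_one]; exact isGlobalAmoeba_singleEdge
  | 2 =>
    rw [fibTree_add_two, fibTree_zero, fibTree_one]
    exact isGlobalAmoeba_singleEdge_join_singleEdge
  | n + 3 =>
    have h := rootedAmoeba_fibTree.{u} (n + 3)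
    rw [fibTree_add_two (n + 1), fibTree_add_two n] at h ⊢
    exact h.isGlobalAmoeba_join_join

lemma IsTree.join {U V : Type*} [Finite U] [Finite V] {G : SimpleGraph U} {H : SimpleGraph V}
    (hG : G.IsTree) (hH : H.IsTree) (r : U) (s : V) : (G.join r H s).IsTree := by
  classical
  cases nonempty_fintype U
  cases nonempty_fintype V
  rw [isTree_iff_connected_and_card] at *
  refine ⟨hG.1.sum_sup_edge hH.1, ?_⟩
  have h := card_edgeFinset_sup_edge (G ⊕g H) (s := Sum.inl r) (t := Sum.inr s) (by simp) (by simp)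
  have h₁ := Nat.card_congr (edgeSetSumEquiv (G := G) (H := H))
  simp only [edgeFinset_card, ← Nat.card_eq_fintype_card] at h
  rw [SimpleGraph.join, h, h₁, Nat.card_sum, Nat.card_sum]
  omega

lemma isTree_singleEdge : singleEdge.{u}.IsTree :=
  ⟨connected_top, .of_card_le_two (by simp)⟩

lemma isTree_fibTree (n : ℕ) : (fibTree.{u} n).G.IsTree := by
  induction n using Nat.twoStepInduction with
  | zero => rw [fibTree_zero]; exact isTree_singleEdge
  | one => rw [fibTree_one]; exact isTree_singleEdge
  | more n ih₁ ih₂ => rw [fibTree_add_two]; exact ih₁.join ih₂ _ _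

lemma card_fibTree (n : ℕ) : Fintype.card (fibTree.{u} n).V = 2 * Nat.fib (n + 1) := by
  induction n using Nat.twoStepInduction with
  | zero => rw [fibTree_zero]; simp
  | one => rw [fibTree_one]; simp
  | more n ih₁ ih₂ =>
    rw [fibTree_add_two, Nat.fib_add_two, mul_add, ← ih₁, ← ih₂]
    exact Fintype.card_sum

/-! ### Degrees -/

section Degree

variable {U V : Type*} [Fintype U] [Fintype V] {G : SimpleGraph U} {H : SimpleGraph V}
  {r : U} {s : V}

open Classical in
lemma degree_join_inl (v : U) :
    (G.join r H s).degree (Sum.inl v) = G.degree v + if v = r then 1 else 0 := by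
  simp only [degree, neighborFinset_eq_filter, Finset.card_filter, Fintype.sum_sum_type,
    join_adj_inl_inl, join_adj_inl_inr]
  split_ifs with h <;> simp [h]

open Classical in
lemma degree_join_inr (v : V) :
    (G.join r H s).degree (Sum.inr v) = H.degree v + if v = s then 1 else 0 := by
  simp only [degree, neighborFinset_eq_filter, Finset.card_filter, Fintype.sum_sum_type,
    join_adj_inr_inl, join_adj_inr_inr]
  split_ifs with h <;> simp [h, add_comm]

end Degree

lemma degree_singleEdge (v : ULift.{u} (Fin 2)) [Fintype (singleEdge.neighborSet v)] :
    singleEdge.degree v = 1 := by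
  classical
  convert complete_graph_degree v
  simp

-- The root gains one neighbour at each join. The index is shifted by one from `T_i`, and the
-- maximum with 1 accounts for `fibTree 0`, also a single edge.
open Classical in
lemma degree_root_fibTree (n : ℕ) :
    (fibTree.{u} n).G.degree (fibTree.{u} n).root = max n 1 := by
  induction n with
  | zero => rw [fibTree_zero]; convert degree_singleEdge _; rfl
  | succ n ih =>
    cases n with
    | zero => rw [fibTree_one]; convert degree_singleEdge _; rfl
    | succ n =>
      rw [fibTree_add_two]
      refine (degree_join_inr _).trans ?_
      simp [ih]

open Classical in
lemma degree_fibTree_le (n : ℕ) (v : (fibTree.{u} n).V) :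
    (fibTree.{u} n).G.degree v ≤ max n 1 := by
  induction n using Nat.twoStepInduction with
  | zero => revert v; rw [fibTree_zero]; exact fun v ↦ le_of_eq (by convert degree_singleEdge v; rfl)
  | one => revert v; rw [fibTree_one]; exact fun v ↦ le_of_eq (by convert degree_singleEdge v; rfl)
  | more n ih₁ ih₂ =>
    revert v
    rw [fibTree_add_two]
    rintro (v | v)
    · refine (degree_join_inl v).trans_le ?_
      have := ih₁ v
      split_ifs <;> omega
    · refine (degree_join_inr v).trans_le ?_
      have := ih₂ v
      split_ifs <;> omega

-- The left root has degree at most `n + 2` even after the join. For `fibTree 2`, a path on four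
-- vertices, this fails: both inner vertices are maximal.
open Classical in
lemma degree_fibTree_lt (n : ℕ) (v : (fibTree.{u} (n + 3)).V)
    (hv : v ≠ (fibTree.{u} (n + 3)).root) : (fibTree.{u} (n + 3)).G.degree v < n + 3 := by
  revert v
  rw [fibTree_add_two]
  rintro (v | v) hv
  · refine (degree_join_inl v).trans_lt ?_
    have := degree_fibTree_le _ v
    split_ifs <;> omega
  · refine (degree_join_inr v).trans_lt ?_
    have := degree_fibTree_le _ v
    have hv : v ≠ (fibTree (n + 1 + 1)).root := fun h ↦ hv (h ▸ rfl)
    rw [if_neg hv]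
    omega

lemma maxDegree_fibTree (n : ℕ) [DecidableRel (fibTree.{u} n).G.Adj] :
    (fibTree.{u} n).G.maxDegree = max n 1 := by
  refine le_antisymm (maxDegree_le_of_forall_degree_le _ _ fun v ↦ ?_) ?_
  · convert degree_fibTree_le n v
  · refine le_trans ?_ (degree_le_maxDegree _ (fibTree.{u} n).root)
    convert (degree_root_fibTree.{u} n).ge

/-! ### Uniqueness up to isomorphism -/

lemma exists_iso_singleEdge (v : ULift.{u} (Fin 2)) :
    ∃ φ : singleEdge.{u} ≃g singleEdge.{u}, φ v = ⟨0⟩ := by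
  classical
  exact ⟨Iso.completeGraph (swap v ⟨0⟩), swap_apply_left v _⟩

/-- The two parts of a join can be exchanged. -/
def Iso.joinComm {U V : Type*} {G : SimpleGraph U} {H : SimpleGraph V} {r : U} {s : V} :
    G.join r H s ≃g H.join s G r where
  toEquiv := Equiv.sumComm U V
  map_rel_iff' := by rintro (x | x) (y | y) <;> simp [and_comm]

-- From index 3 on the root is the only vertex of maximum degree; the smaller trees are symmetric
-- enough to move any such vertex to it.
open Classical in
lemma exists_iso_of_degree_eq_max (n : ℕ) (v : (fibTree.{u} n).V)
    (hv : (fibTree.{u} n).G.degree v = max n 1) :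
    ∃ φ : (fibTree.{u} n).G ≃g (fibTree.{u} n).G, φ v = (fibTree.{u} n).root := by
  match n, v, hv with
  | 0, v, hv => clear hv; revert v; rw [fibTree_zero]; exact exists_iso_singleEdge
  | 1, v, hv => clear hv; revert v; rw [fibTree_one]; exact exists_iso_singleEdge
  | 2, v, hv =>
    revert v
    rw [fibTree_add_two, fibTree_zero, fibTree_one]
    rintro (v | v) hv
    · replace hv := (degree_join_inl (G := singleEdge) (H := singleEdge) (r := ⟨0⟩) (s := ⟨0⟩)
        v).symm.trans hv
      rw [degree_singleEdge] at hv
      have hv : v = ⟨0⟩ := by by_contra h; simp [h] at hv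
      exact ⟨Iso.joinComm, by rw [hv]; rfl⟩
    · replace hv := (degree_join_inr (G := singleEdge) (H := singleEdge) (r := ⟨0⟩) (s := ⟨0⟩)
        v).symm.trans hv
      rw [degree_singleEdge] at hv
      have hv : v = ⟨0⟩ := by by_contra h; simp [h] at hv
      exact ⟨.refl, by rw [hv]; rfl⟩
  | n + 3, v, hv =>
    refine ⟨.refl, ?_⟩
    by_contra h
    have h1 := degree_fibTree_lt n v h
    omega

/-- All vertices of maximum degree of a Fibonacci tree are equivalent under automorphisms. -/
lemma exists_iso_apply_eq_root (n : ℕ) [DecidableRel (fibTree.{u} n).G.Adj]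
    (v : (fibTree.{u} n).V) (hv : (fibTree.{u} n).G.degree v = (fibTree.{u} n).G.maxDegree) :
    ∃ φ : (fibTree.{u} n).G ≃g (fibTree.{u} n).G, φ v = (fibTree.{u} n).root := by
  rw [maxDegree_fibTree] at hv
  exact exists_iso_of_degree_eq_max n v (by convert hv)

/-- Isomorphisms that respect the roots extend to joins. -/
def Iso.join {U V U' V' : Type*} {G : SimpleGraph U} {H : SimpleGraph V} {G' : SimpleGraph U'}
    {H' : SimpleGraph V'} (f : G ≃g G') (g : H ≃g H') {r : U} {s : V} {r' : U'} {s' : V'}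
    (hr : f r = r') (hs : g s = s') : G.join r H s ≃g G'.join r' H' s' where
  toEquiv := Equiv.sumCongr f.toEquiv g.toEquiv
  map_rel_iff' := by
    subst hr hs
    rintro (x | x) (y | y) <;> simp [← f.map_adj_iff, ← g.map_adj_iff]

/-- Inductively each part is a standard tree, and an automorphism takes the chosen vertex of maximum
degree to its root, so the choice does not matter. -/
lemma IsFibonacciTree.exists_iso_fibTree {i : ℕ} {V : Type u} {G : SimpleGraph V}
    (h : G.IsFibonacciTree i) : 1 ≤ i ∧ Nonempty (G ≃g (fibTree.{u} (i - 1)).G) := by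
  induction h with
  | one φ => exact ⟨le_rfl, by rw [fibTree_zero]; exact ⟨φ.trans (Iso.completeGraph Equiv.ulift.symm)⟩⟩
  | two φ =>
    exact ⟨one_le_two, by rw [fibTree_one]; exact ⟨φ.trans (Iso.completeGraph Equiv.ulift.symm)⟩⟩
  | @step i _ _ _ _ _ H H' _ _ _ _ _ r r' hr hr' φ ih ih' =>
    classical
    obtain ⟨-, ⟨f⟩⟩ := ih
    obtain ⟨-, ⟨f'⟩⟩ := ih'
    change H ≃g (fibTree i).G at f
    change H' ≃g (fibTree (i + 1)).G at f'
    obtain ⟨g, hg⟩ := exists_iso_apply_eq_root i (f r) (by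
      rw [f.degree_eq, hr]; exact f.maxDegree_eq)
    obtain ⟨g', hg'⟩ := exists_iso_apply_eq_root (i + 1) (f' r') (by
      rw [f'.degree_eq, hr']; exact f'.maxDegree_eq)
    refine ⟨by omega, ?_⟩
    rw [show i + 3 - 1 = i + 2 by omega, fibTree_add_two]
    exact ⟨φ.trans (Iso.join (f.trans g) (f'.trans g') hg hg')⟩

lemma isFibonacciTree_fibTree (n : ℕ) : (fibTree.{u} n).G.IsFibonacciTree (n + 1) := by
  classical
  induction n using Nat.twoStepInduction with
  | zero => rw [fibTree_zero]; exact .one (Iso.completeGraph Equiv.ulift)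
  | one => rw [fibTree_one]; exact .two (Iso.completeGraph Equiv.ulift)
  | more n ih₁ ih₂ =>
    have hr (n : ℕ) : (fibTree.{u} n).G.degree (fibTree.{u} n).root
        = (fibTree.{u} n).G.maxDegree := by
      rw [maxDegree_fibTree, degree_root_fibTree]
    rw [fibTree_add_two]
    exact .step ih₁ ih₂ _ _ (hr n) (hr (n + 1)) .refl

end SimpleGraph

/-- For every `i ≥ 1` the Fibonacci tree `T_i` exists and is unique up to isomorphism; it is a tree
of order `2 F_i`, of maximum degree `i - 1` if `i ≥ 2`, and a global amoeba; in particular there are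
global amoebas among the `T_i` of arbitrarily large maximum degree. -/
theorem mainTheorem3 :
    (∀ i : ℕ, 1 ≤ i →
      ∃ (V : Type u) (_ : Fintype V) (G : SimpleGraph V), G.IsFibonacciTree i) ∧
    (∀ (i : ℕ) (V W : Type u) (G : SimpleGraph V) (H : SimpleGraph W),
      G.IsFibonacciTree i → H.IsFibonacciTree i → Nonempty (G ≃g H)) ∧
    (∀ (i : ℕ) (V : Type u) [Fintype V] (G : SimpleGraph V) [DecidableRel G.Adj],
      1 ≤ i → G.IsFibonacciTree i →
        G.IsTree ∧ Fintype.card V = 2 * Nat.fib i ∧ (2 ≤ i → G.maxDegree = i - 1) ∧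
          G.IsGlobalAmoeba) ∧
    (∀ d : ℕ, ∃ (i : ℕ) (V : Type u) (_ : Fintype V) (G : SimpleGraph V)
      (_ : DecidableRel G.Adj),
        1 ≤ i ∧ G.IsFibonacciTree i ∧ G.IsGlobalAmoeba ∧ d ≤ G.maxDegree) := by
  refine ⟨fun i hi ↦ ?_, fun i V W G H hG hH ↦ ?_, fun i V _ G _ hi hG ↦ ?_, fun d ↦ ?_⟩
  · obtain ⟨n, rfl⟩ := Nat.exists_eq_add_of_le' hi
    exact ⟨_, inferInstance, _, SimpleGraph.isFibonacciTree_fibTree n⟩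
  · obtain ⟨-, ⟨f⟩⟩ := hG.exists_iso_fibTree
    obtain ⟨-, ⟨g⟩⟩ := hH.exists_iso_fibTree
    exact ⟨f.trans g.symm⟩
  · classical
    obtain ⟨n, rfl⟩ := Nat.exists_eq_add_of_le' hi
    obtain ⟨-, ⟨f⟩⟩ := hG.exists_iso_fibTree
    rw [Nat.add_sub_cancel] at f
    refine ⟨f.isTree_iff.2 (SimpleGraph.isTree_fibTree n), ?_, fun hn ↦ ?_,
      (SimpleGraph.isGlobalAmoeba_fibTree n).of_iso f.symm⟩
    · rw [Fintype.card_congr f.toEquiv, SimpleGraph.card_fibTree]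
    · rw [f.maxDegree_eq, SimpleGraph.maxDegree_fibTree]
      omega
  · classical
    refine ⟨d + 1, _, inferInstance, (SimpleGraph.fibTree.{u} d).G, inferInstance, by omega,
      SimpleGraph.isFibonacciTree_fibTree d, SimpleGraph.isGlobalAmoeba_fibTree d, ?_⟩
    rw [SimpleGraph.maxDegree_fibTree]
    exact le_max_left d 1
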